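/- Let $m,n\ge 2$ be integers, $N=m+n$, $a_N=\frac{4(N-1)}{N-2}$ and $p=\frac{2N}{N-2}$. Let $L^2_1(\mathbb R^n)$ be the Sobolev space of functions in $L^2(\mathbb R^n)$ whose weak gradient is in $L^2(\mathbb R^n)$, and for $u\in L_1^2(\mathbb R^n)\setminus\{0\}$ put $$Y(u)=\frac{\int_{\mathbb R^n}\left(a_N|\nabla u|^2+m(m-1)u^2\right)}{\left(\int_{\mathbb R^n}|u|^p\right)^{2/p}} .$$ Let $f:\mathbb R^n\to\mathbb R_{>0}$ be the normalized minimizer of $Y$, that is, a positive, smooth function in $L^2_1(\mathbb R^n)$, radial about the origin and decreasing in $|x|$, with $Y(f)\le Y(u)$ for all $u\in L^2_1(\mathbb R^n)\setminus\{0\}$, normalized by $$-a_N\Delta f+m(m-1)f=m(m-1)f^{p-1}$$ (equivalently, for a Riemannian $m$-manifold $(M,g)$ of constant scalar curvature $m(m-1)$, the metric $f^{p-2}(g+g_E)$ on $M\times\mathbb R^n$ has scalar curvature $m(m-1)$). For $\lambda\ge 0$ let $$A(\lambda)=\inf_{b\in L_1^2(\mathbb R^n)\setminus\{0\}}\left(\frac{\int_{\mathbb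 R^n}\left(a_N|\nabla b|^2+m(m-1)b^2\right)}{\int_{\mathbb R^n}f^{p-2}b^2}+a_N\lambda\,\frac{\int_{\mathbb R^n}b^2}{\int_{\mathbb R^n}f^{p-2}b^2}\right).$$ Then $A(\lambda)$ is finite for every $\lambda\ge0$, and $A$ is a strictly increasing function on $[0,\infty)$. Moreover, there is a unique $\lambda>0$ such that $$A(\lambda)=(p-1)\,m(m-1).$$ (This value of $\lambda$ is denoted $\lambda(m,n)$.) -/

import Mathlib

open MeasureTheory

open scoped ContDiff Laplacian Gradient

noncomputable section

namespace YamabeStability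

/-- Euclidean space `ℝⁿ`. -/
abbrev Euc (n : ℕ) : Type := EuclideanSpace ℝ (Fin n)

/-- The constant `a_N = 4 (N - 1) / (N - 2)`. -/
def aConst (N : ℕ) : ℝ := 4 * ((N : ℝ) - 1) / ((N : ℝ) - 2)

/-- The critical Sobolev exponent `p = p_N = 2 N / (N - 2)`. -/
def pExp (N : ℕ) : ℝ := 2 * (N : ℝ) / ((N : ℝ) - 2)

/-- The scalar curvature `m (m - 1)`. -/
def scal (m : ℕ) : ℝ := (m : ℝ) * ((m : ℝ) - 1)

/-- `G` is a weak (distributional) gradient of `u` on `ℝⁿ`: for every test function `φ` and every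
direction `v`, `∫ u ∂_v φ = - ∫ φ ⟨G, v⟩`. -/
def IsWeakGradient {n : ℕ} (u : Euc n → ℝ) (G : Euc n → Euc n) : Prop :=
  LocallyIntegrable u volume ∧ LocallyIntegrable G volume ∧
    ∀ φ : Euc n → ℝ, ContDiff ℝ ∞ φ → HasCompactSupport φ → ∀ v : Euc n,
      ∫ x, u x * fderiv ℝ φ x v = -∫ x, φ x * inner ℝ (G x) v

/-- `u` belongs to the Sobolev space `L²₁(ℝⁿ)` (square integrable, with square integrable weak
gradient) and `G` is its weak gradient, which is unique up to equality almost everywhere. -/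
structure IsSobolevPair {n : ℕ} (u : Euc n → ℝ) (G : Euc n → Euc n) : Prop where
  memLp : MemLp u 2 volume
  memLp_grad : MemLp G 2 volume
  isWeakGradient : IsWeakGradient u G

/-- `u` belongs to `L²₁(ℝⁿ) - {0}` (so `u` is not almost everywhere zero), with weak
gradient `G`. -/
structure IsNonzeroSobolevPair {n : ℕ} (u : Euc n → ℝ) (G : Euc n → Euc n) : Prop
    extends IsSobolevPair u G where
  ne_zero : ¬ u =ᵐ[volume] 0

/-- The energy `∫ (a_N |∇u|² + m (m - 1) u²)` over `ℝⁿ`, with `N = m + n`; `G` stands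
for `∇u`. -/
def energy (m n : ℕ) (u : Euc n → ℝ) (G : Euc n → Euc n) : ℝ :=
  ∫ x, (aConst (m + n) * ‖G x‖ ^ 2 + scal m * u x ^ 2)

/-- The Yamabe functional of `M × ℝⁿ` on functions of the Euclidean variable alone, where `M` has
dimension `m` and scalar curvature `m (m - 1)`: the energy divided by `‖u‖_p²`. The volume of `M`
contributes only a constant factor, which is omitted. -/
def yamabeQuotient (m n : ℕ) (u : Euc n → ℝ) (G : Euc n → Euc n) : ℝ :=
  energy m n u G / (∫ x, |u x| ^ pExp (m + n)) ^ (2 / pExp (m + n))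

/-- `f` is the normalized minimizer: a positive, smooth, radial (about the origin), decreasing
function in `L²₁(ℝⁿ)` which minimizes the Yamabe functional among functions of the Euclidean
variable, normalized so that the metric `f ^ (p - 2) (g + g_E)` has scalar curvature `m (m - 1)`. -/
structure IsNormalizedMinimizer (m n : ℕ) (f : Euc n → ℝ) : Prop where
  pos : ∀ x, 0 < f x
  smooth : ContDiff ℝ ∞ f
  radial : ∀ x y, ‖x‖ = ‖y‖ → f x = f y
  decreasing : ∀ x y, ‖x‖ ≤ ‖y‖ → f y ≤ f x
  sobolev : IsSobolevPair f (∇ f)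
  minimizes : ∀ (u : Euc n → ℝ) (G : Euc n → Euc n), IsNonzeroSobolevPair u G →
    yamabeQuotient m n f (∇ f) ≤ yamabeQuotient m n u G
  normalized : ∀ x, -(aConst (m + n) * Δ f x) + scal m * f x =
    scal m * f x ^ (pExp (m + n) - 1)

/-- The weighted integral `∫ f ^ (p - 2) b²` over `ℝⁿ`. -/
def weightedNorm (m n : ℕ) (f b : Euc n → ℝ) : ℝ :=
  ∫ x, f x ^ (pExp (m + n) - 2) * b x ^ 2

/-- The set of values, for `b` in `L²₁(ℝⁿ) - {0}`, of
`∫ (a_N |∇b|² + m (m - 1) b²) / ∫ f ^ (p - 2) b² + a_N lam ∫ b² / ∫ f ^ (p - 2) b²`. -/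
def quotientValues (m n : ℕ) (f : Euc n → ℝ) (lam : ℝ) : Set ℝ :=
  {q | ∃ (b : Euc n → ℝ) (G : Euc n → Euc n), IsNonzeroSobolevPair b G ∧
    q = energy m n b G / weightedNorm m n f b +
      aConst (m + n) * lam * ((∫ x, b x ^ 2) / weightedNorm m n f b)}

/-- The function `A(lam)`, the infimum of the above quotients. -/
def A (m n : ℕ) (f : Euc n → ℝ) (lam : ℝ) : ℝ :=
  sInf (quotientValues m n f lam)

end YamabeStability

end

/-!
Write `E(b)` for the energy, `B(b) = ∫ b²` and `W(b) = ∫ f ^ (p - 2) b²`. For each admissible `b`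
the quotient is the affine function `lam ↦ E(b) / W(b) + a_N lam B(b) / W(b)`, so `A` is an infimum
of affine functions, and the theorem follows from three inequalities.

* `f` is largest at the origin, so `W(b) ≤ f(0) ^ (p - 2) B(b)`
  (`IsNormalizedMinimizer.weightedNorm_le`). The slopes are therefore bounded below by a positive
  constant. This makes `A` strictly increasing and unbounded (`affineInf_add_le`).
* `m (m - 1) B(b) ≤ E(b)` (`scal_mul_integral_sq_le_energy`). A near-minimizer at `lam` thus has
  slope bounded in terms of `A(lam)`, which makes `A` continuous on `[0, ∞)`
  (`affineInf_le_mul`, `continuousOn_affineInf`).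
* `A(0) ≤ E(f) / W(f) = m (m - 1) < (p - 1) m (m - 1)`. The equality is the equation of `f` tested
  against `f` (`IsNormalizedMinimizer.energy_eq`), and it rests on Green's identity on all of `ℝⁿ`
  for `f` with `f` and `∇f` square integrable and `f Δf` integrable
  (`integral_norm_gradient_sq_add_mul_laplacian`).

The intermediate value theorem then yields the unique `lam > 0`; no minimizer of the quotient is
needed.
-/

noncomputable section

namespace YamabeStability

open Filter Topology

/-! ### Green's identity for square integrable functions -/

section Green

variable {E : Type*} [NormedAddCommGroup E] [InnerProductSpace ℝ E] [FiniteDimensional ℝ E]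

theorem laplacian_eq_sum_fderiv_fderiv {ι : Type*} [Fintype ι] (e : OrthonormalBasis ι ℝ E)
    {f : E → ℝ} (hf : ContDiff ℝ 2 f) (x : E) :
    Δ f x = ∑ i, fderiv ℝ (fun y ↦ fderiv ℝ f y (e i)) x (e i) := by
  have hd : DifferentiableAt ℝ (fderiv ℝ f) x :=
    (hf.fderiv_right (m := 1) (by norm_num)).differentiable one_ne_zero x
  simp only [InnerProductSpace.laplacian_eq_iteratedFDeriv_orthonormalBasis f e,
    iteratedFDeriv_two_apply, Matrix.cons_val_zero, Matrix.cons_val_one]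
  refine Finset.sum_congr rfl fun i _ ↦ ?_
  rw [fderiv_clm_apply hd (differentiableAt_const _)]
  simp

/-- The divergence of `χ f ∇f`, written in an orthonormal basis. -/
theorem sum_fderiv_mul_mul_fderiv {ι : Type*} [Fintype ι] (e : OrthonormalBasis ι ℝ E)
    {χ f : E → ℝ} (hχ : ContDiff ℝ 1 χ) (hf : ContDiff ℝ 2 f) (x : E) :
    ∑ i, fderiv ℝ (fun y ↦ χ y * f y * fderiv ℝ f y (e i)) x (e i) =
      f x * inner ℝ (∇ χ x) (∇ f x) + χ x * (‖∇ f x‖ ^ 2 + f x * Δ f x) := by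
  have hχd : DifferentiableAt ℝ χ x := hχ.differentiable one_ne_zero x
  have hfd : DifferentiableAt ℝ f x := hf.differentiable two_ne_zero x
  have hd (i : ι) : DifferentiableAt ℝ (fun y ↦ fderiv ℝ f y (e i)) x :=
    ((hf.fderiv_right (m := 1) (by norm_num)).clm_apply contDiff_const).differentiable
      one_ne_zero x
  have hgrad (u : E → ℝ) (i : ι) : inner ℝ (∇ u x) (e i) = fderiv ℝ u x (e i) := by
    rw [← InnerProductSpace.toDual_apply_apply, toDual_gradient]
  have hterm (i : ι) : fderiv ℝ (fun y ↦ χ y * f y * fderiv ℝ f y (e i)) x (e i) =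
      f x * (inner ℝ (∇ χ x) (e i) * inner ℝ (e i) (∇ f x)) +
        χ x * (inner ℝ (∇ f x) (e i) * inner ℝ (e i) (∇ f x) +
          f x * fderiv ℝ (fun y ↦ fderiv ℝ f y (e i)) x (e i)) := by
    rw [fderiv_fun_mul (hχd.fun_mul hfd) (hd i), fderiv_fun_mul hχd hfd,
      real_inner_comm (∇ f x) (e i), hgrad, hgrad]
    simp only [add_apply, smul_apply, smul_eq_mul]
    ring
  simp only [hterm, Finset.sum_add_distrib, ← Finset.mul_sum, e.sum_inner_mul_inner,
    real_inner_self_eq_norm_sq, laplacian_eq_sum_fderiv_fderiv e hf]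

variable [MeasurableSpace E] [BorelSpace E]

theorem integral_fderiv_apply_eq_zero {h : E → ℝ} (hh : ContDiff ℝ 1 h)
    (hc : HasCompactSupport h) (v : E) : ∫ x, fderiv ℝ h x v = 0 := by
  have h1 : Integrable (fun x ↦ fderiv ℝ h x v) :=
    (hh.continuous_fderiv_apply one_ne_zero |>.comp (by fun_prop :
      Continuous fun x : E ↦ (x, v))).integrable_of_hasCompactSupport (hc.fderiv_apply ℝ v)
  -- Integration by parts against the constant function `1`.
  have := integral_mul_fderiv_eq_neg_fderiv_mul_of_integrable (μ := (volume : Measure E))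
    (f := fun _ ↦ (1 : ℝ)) (g := h) (v := v) (by simp) (by simpa using h1)
    (by simpa using hh.continuous.integrable_of_hasCompactSupport hc)
    (by simp) (fun x _ ↦ hh.differentiable one_ne_zero x)
  simpa using this

/-- Green's first identity for `f`, localized by a compactly supported factor `χ`: the divergence
of `χ f ∇f` integrates to zero. -/
theorem integral_cutoff_green {χ f : E → ℝ} (hχ : ContDiff ℝ 1 χ) (hc : HasCompactSupport χ)
    (hf : ContDiff ℝ 2 f) :
    ∫ x, (f x * inner ℝ (∇ χ x) (∇ f x) + χ x * (‖∇ f x‖ ^ 2 + f x * Δ f x)) = 0 := by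
  let e := stdOrthonormalBasis ℝ E
  have hsm (i) : ContDiff ℝ 1 (fun y ↦ χ y * f y * fderiv ℝ f y (e i)) :=
    (hχ.mul (hf.of_le one_le_two)).mul
      ((hf.fderiv_right (m := 1) (by norm_num)).clm_apply contDiff_const)
  have hcs (i) : HasCompactSupport (fun y ↦ χ y * f y * fderiv ℝ f y (e i)) :=
    (hc.mul_right (f' := f)).mul_right
  simp_rw [← sum_fderiv_mul_mul_fderiv e hχ hf]
  rw [integral_finsetSum]
  · exact Finset.sum_eq_zero fun i _ ↦ integral_fderiv_apply_eq_zero (hsm i) (hcs i) _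
  · intro i _
    exact ((hsm i).continuous_fderiv_apply one_ne_zero |>.comp (by fun_prop :
      Continuous fun x : E ↦ (x, e i))).integrable_of_hasCompactSupport ((hcs i).fderiv_apply ℝ _)

/-- Green's first identity on the whole space: no boundary term appears when `f` and `∇f` are
square integrable. In the proof, the cutoffs are the dilates `χ (x / (k + 1))` of one bump
function, whose gradients are bounded by `C / (k + 1)`. -/
theorem integral_norm_gradient_sq_add_mul_laplacian {f : E → ℝ} (hf : ContDiff ℝ 2 f)
    (hf2 : MemLp f 2) (hg2 : MemLp (∇ f) 2) (hint : Integrable fun x ↦ f x * Δ f x) :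
    ∫ x, (‖∇ f x‖ ^ 2 + f x * Δ f x) = 0 := by
  let χ : ContDiffBump (0 : E) := ⟨1, 2, one_pos, one_lt_two⟩
  have hχ : ContDiff ℝ 1 (χ : E → ℝ) := χ.contDiff
  obtain ⟨C, hC⟩ := (χ.hasCompactSupport.fderiv (𝕜 := ℝ)).exists_bound_of_continuous
    (hχ.continuous_fderiv one_ne_zero)
  let r : ℕ → ℝ := fun k ↦ ((k : ℝ) + 1)⁻¹
  have hr0 (k) : 0 < r k := by positivity
  have hr1 (k) : r k ≤ 1 := inv_le_one_of_one_le₀ (by simp)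
  have hr : Tendsto r atTop (𝓝 0) := by
    simpa [r] using tendsto_one_div_add_atTop_nhds_zero_nat (𝕜 := ℝ)
  let X : ℕ → E → ℝ := fun k x ↦ χ (r k • x)
  have hX (k) : ContDiff ℝ 1 (X k) := hχ.comp (contDiff_const_smul (r k))
  have hXc (k) : HasCompactSupport (X k) := χ.hasCompactSupport.comp_smul (hr0 k).ne'
  have hXg (k) (x) : ‖∇ (X k) x‖ ≤ r k * C := by
    have h1 : ‖∇ (X k) x‖ = ‖fderiv ℝ (X k) x‖ := by
      rw [gradient, LinearIsometryEquiv.norm_map]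
    rw [h1, fderiv_comp_smul, norm_smul, Real.norm_of_nonneg (hr0 k).le]
    exact mul_le_mul_of_nonneg_left (hC _) (hr0 k).le
  have hC0 : 0 ≤ C := (norm_nonneg _).trans (hC 0)
  have hgc : Continuous (∇ f) := by
    unfold gradient
    exact (LinearIsometryEquiv.continuous _).comp (hf.continuous_fderiv two_ne_zero)
  have hsum : Integrable fun x ↦ ‖∇ f x‖ ^ 2 + f x * Δ f x :=
    (hg2.integrable_norm_pow two_ne_zero).add hint
  have hprod : Integrable fun x ↦ ‖f x‖ * ‖∇ f x‖ := hf2.norm.integrable_mul hg2.norm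
  have hlim : Tendsto (fun k ↦ ∫ x, (f x * inner ℝ (∇ (X k) x) (∇ f x) +
      X k x * (‖∇ f x‖ ^ 2 + f x * Δ f x))) atTop
      (𝓝 (∫ x, (‖∇ f x‖ ^ 2 + f x * Δ f x))) := by
    have hinner (k) (x) : ‖f x * inner ℝ (∇ (X k) x) (∇ f x)‖ ≤
        r k * (C * (‖f x‖ * ‖∇ f x‖)) := by
      rw [norm_mul]
      calc ‖f x‖ * ‖inner ℝ (∇ (X k) x) (∇ f x)‖
          ≤ ‖f x‖ * (‖∇ (X k) x‖ * ‖∇ f x‖) := by gcongr; exact norm_inner_le_norm _ _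
        _ ≤ ‖f x‖ * ((r k * C) * ‖∇ f x‖) := by gcongr; exact hXg k x
        _ = _ := by ring
    refine tendsto_integral_of_dominated_convergence
      (fun x ↦ C * (‖f x‖ * ‖∇ f x‖) + ‖‖∇ f x‖ ^ 2 + f x * Δ f x‖)
      (fun k ↦ ?_) ((hprod.const_mul C).add hsum.norm) (fun k ↦ ?_) ?_
    · have hXgc : Continuous (∇ (X k)) := by
        unfold gradient
        exact (LinearIsometryEquiv.continuous _).comp ((hX k).continuous_fderiv one_ne_zero)
      exact ((hf.continuous.mul (hXgc.inner hgc)).aestronglyMeasurable).add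
        ((hX k).continuous.aestronglyMeasurable.mul hsum.aestronglyMeasurable)
    · refine Eventually.of_forall fun x ↦ (norm_add_le _ _).trans (add_le_add ?_ ?_)
      · exact (hinner k x).trans (mul_le_of_le_one_left (by positivity) (hr1 k))
      · rw [norm_mul, Real.norm_of_nonneg χ.nonneg]
        exact mul_le_of_le_one_left (norm_nonneg _) χ.le_one
    · refine Eventually.of_forall fun x ↦ ?_
      have h1 : Tendsto (fun k ↦ f x * inner ℝ (∇ (X k) x) (∇ f x)) atTop (𝓝 0) :=
        squeeze_zero_norm (fun k ↦ hinner k x) (by simpa using hr.mul_const _)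
      have h2 : Tendsto (fun k ↦ X k x) atTop (𝓝 1) := by
        have h3 : Tendsto (fun k ↦ r k • x) atTop (𝓝 0) := by simpa using hr.smul_const x
        refine tendsto_const_nhds.congr' ?_
        filter_upwards [h3.eventually χ.eventuallyEq_one] with k hk
        simpa [X] using hk.symm
      simpa using h1.add (h2.mul_const (‖∇ f x‖ ^ 2 + f x * Δ f x))
  simp_rw [fun k ↦ integral_cutoff_green (hX k) (hXc k) hf] at hlim
  exact tendsto_nhds_unique hlim tendsto_const_nhds

end Green

/-! ### Infima of affine functions -/

section AffineInfimum

/-- The infimum of the affine functions `t ↦ α i + c * t * β i`. -/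
def affineInf {ι : Type*} (α β : ι → ℝ) (c t : ℝ) : ℝ :=
  ⨅ i, (α i + c * t * β i)

variable {ι : Type*} {α β : ι → ℝ} {c s δ : ℝ}

theorem bddBelow_affine (hc : 0 < c) (hs : 0 < s) (hδ : 0 < δ) (hβ : ∀ i, δ ≤ β i)
    (hα : ∀ i, s * β i ≤ α i) {t : ℝ} (ht : 0 ≤ t) :
    BddBelow (Set.range fun i ↦ α i + c * t * β i) := by
  refine ⟨0, ?_⟩
  rintro _ ⟨i, rfl⟩
  have hβi := hδ.trans_le (hβ i)
  have := (mul_pos hs hβi).le.trans (hα i)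
  positivity

variable [Nonempty ι]

/-- The slopes are at least `c * δ`, and so is the slope of the infimum. -/
theorem affineInf_add_le (hc : 0 < c) (hs : 0 < s) (hδ : 0 < δ) (hβ : ∀ i, δ ≤ β i)
    (hα : ∀ i, s * β i ≤ α i) {t u : ℝ} (ht : 0 ≤ t) (htu : t ≤ u) :
    affineInf α β c t + c * δ * (u - t) ≤ affineInf α β c u := by
  refine le_ciInf fun i ↦ ?_
  have h1 : affineInf α β c t ≤ α i + c * t * β i :=
    ciInf_le (bddBelow_affine hc hs hδ hβ hα ht) i
  have h2 : c * (u - t) * δ ≤ c * (u - t) * β i :=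
    mul_le_mul_of_nonneg_left (hβ i) (mul_nonneg hc.le (sub_nonneg.2 htu))
  linarith

/-- Since `β i ≤ α i / s`, the slope of an affine function is controlled by its value: this bounds
the growth of the infimum, although the slopes themselves may be unbounded. -/
theorem affineInf_le_mul (hc : 0 < c) (hs : 0 < s) (hδ : 0 < δ) (hβ : ∀ i, δ ≤ β i)
    (hα : ∀ i, s * β i ≤ α i) {t u : ℝ} (ht : 0 ≤ t) (htu : t ≤ u) :
    affineInf α β c u ≤ affineInf α β c t * (1 + c * (u - t) / s) := by
  have hk : 0 < 1 + c * (u - t) / s := by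
    have := sub_nonneg.2 htu
    positivity
  rw [← div_le_iff₀ hk]
  refine le_ciInf fun i ↦ ?_
  rw [div_le_iff₀ hk]
  refine (ciInf_le (bddBelow_affine hc hs hδ hβ hα (ht.trans htu)) i).trans ?_
  have hβi := hδ.trans_le (hβ i)
  have h1 : β i ≤ (α i + c * t * β i) / s := by
    rw [le_div_iff₀ hs]
    have : 0 ≤ c * t * β i := by positivity
    linarith [hα i]
  have h2 := mul_le_mul_of_nonneg_left h1 (mul_nonneg hc.le (sub_nonneg.2 htu))
  calc α i + c * u * β i = α i + c * t * β i + c * (u - t) * β i := by ring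
    _ ≤ α i + c * t * β i + c * (u - t) * ((α i + c * t * β i) / s) := by gcongr
    _ = _ := by ring

theorem strictMonoOn_affineInf (hc : 0 < c) (hs : 0 < s) (hδ : 0 < δ) (hβ : ∀ i, δ ≤ β i)
    (hα : ∀ i, s * β i ≤ α i) : StrictMonoOn (affineInf α β c) (Set.Ici 0) := by
  intro t ht u _ htu
  have := affineInf_add_le hc hs hδ hβ hα ht htu.le
  have : 0 < c * δ * (u - t) := mul_pos (mul_pos hc hδ) (sub_pos.2 htu)
  linarith

theorem continuousOn_affineInf (hc : 0 < c) (hs : 0 < s) (hδ : 0 < δ) (hβ : ∀ i, δ ≤ β i)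
    (hα : ∀ i, s * β i ≤ α i) (T : ℝ) : ContinuousOn (affineInf α β c) (Set.Icc 0 T) := by
  have hmono := (strictMonoOn_affineInf hc hs hδ hβ hα).monotoneOn
  have hdist : ∀ t ∈ Set.Icc 0 T, ∀ u ∈ Set.Icc 0 T, t ≤ u →
      |affineInf α β c u - affineInf α β c t| ≤ affineInf α β c T * (c / s) * |u - t| := by
    intro t ht u hu htu
    have h1 := affineInf_le_mul hc hs hδ hβ hα ht.1 htu
    have h2 := hmono ht.1 hu.1 htu
    have h3 := hmono ht.1 (ht.1.trans ht.2) ht.2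
    have h4 : 0 ≤ c / s * (u - t) := mul_nonneg (by positivity) (sub_nonneg.2 htu)
    rw [abs_of_nonneg (sub_nonneg.2 h2), abs_of_nonneg (sub_nonneg.2 htu)]
    calc affineInf α β c u - affineInf α β c t ≤ affineInf α β c t * (c / s * (u - t)) := by
          linear_combination h1
      _ ≤ affineInf α β c T * (c / s * (u - t)) := by gcongr
      _ = _ := by ring
  refine (LipschitzOnWith.of_dist_le' (K := affineInf α β c T * (c / s))
    fun t ht u hu ↦ ?_).continuousOn
  rw [Real.dist_eq, Real.dist_eq]
  rcases le_total t u with h | h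
  · rw [abs_sub_comm, abs_sub_comm t u]
    exact hdist t ht u hu h
  · exact hdist u hu t ht h

theorem existsUnique_affineInf_eq (hc : 0 < c) (hs : 0 < s) (hδ : 0 < δ) (hβ : ∀ i, δ ≤ β i)
    (hα : ∀ i, s * β i ≤ α i) {y : ℝ} (hy : affineInf α β c 0 < y) :
    ∃! t, 0 < t ∧ affineInf α β c t = y := by
  have hcδ : 0 < c * δ := mul_pos hc hδ
  -- At `T = (y - affineInf 0) / (c δ)` the lower bound on the slope gives the value `y` or more.
  have hT : 0 ≤ (y - affineInf α β c 0) / (c * δ) := div_nonneg (sub_nonneg.2 hy.le) hcδ.le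
  have hyT := affineInf_add_le hc hs hδ hβ hα le_rfl hT
  rw [sub_zero, mul_div_cancel₀ _ hcδ.ne', add_sub_cancel] at hyT
  obtain ⟨t, ht, hty⟩ :=
    intermediate_value_Icc hT (continuousOn_affineInf hc hs hδ hβ hα _) ⟨hy.le, hyT⟩
  refine ⟨t, ⟨lt_of_le_of_ne ht.1 ?_, hty⟩, fun u hu ↦ ?_⟩
  · rintro rfl
    exact hy.ne hty
  · exact (strictMonoOn_affineInf hc hs hδ hβ hα).injOn hu.1.le ht.1 (hu.2.trans hty.symm)

end AffineInfimum

/-! ### Positivity of the constants -/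

section Constants

variable {m n : ℕ}

theorem two_lt_cast_add (hm : 2 ≤ m) (hn : 2 ≤ n) : (2 : ℝ) < ((m + n : ℕ) : ℝ) := by
  exact_mod_cast (by omega : 2 < m + n)

theorem aConst_pos (hm : 2 ≤ m) (hn : 2 ≤ n) : 0 < aConst (m + n) := by
  have h := two_lt_cast_add hm hn
  exact div_pos (by linarith) (by linarith)

theorem two_lt_pExp (hm : 2 ≤ m) (hn : 2 ≤ n) : 2 < pExp (m + n) := by
  have h := two_lt_cast_add hm hn
  rw [pExp, lt_div_iff₀ (by linarith)]
  linarith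

theorem scal_pos (hm : 2 ≤ m) : 0 < scal m := by
  have h : (2 : ℝ) ≤ m := by exact_mod_cast hm
  exact mul_pos (by linarith) (by linarith)

end Constants

/-! ### The integrals in the quotient -/

section Integrals

variable {m n : ℕ} {b : Euc n → ℝ} {G : Euc n → Euc n}

theorem IsNonzeroSobolevPair.integral_sq_pos (h : IsNonzeroSobolevPair b G) :
    0 < ∫ x, b x ^ 2 := by
  rw [integral_pos_iff_support_of_nonneg (fun x ↦ sq_nonneg _) h.memLp.integrable_sq]
  refine pos_iff_ne_zero.2 fun h0 ↦ h.ne_zero ?_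
  refine ae_iff.2 ?_
  simpa [Function.support] using h0

theorem scal_mul_integral_sq_le_energy (hm : 2 ≤ m) (hn : 2 ≤ n) (h : IsSobolevPair b G) :
    scal m * ∫ x, b x ^ 2 ≤ energy m n b G := by
  rw [← integral_const_mul]
  refine integral_mono (h.memLp.integrable_sq.const_mul _)
    (((h.memLp_grad.integrable_norm_pow two_ne_zero).const_mul _).add
      (h.memLp.integrable_sq.const_mul _)) fun x ↦ ?_
  have := (aConst_pos hm hn).le
  exact le_add_of_nonneg_left (by positivity)

variable {f : Euc n → ℝ}

theorem IsNormalizedMinimizer.rpow_sub_two_le (hf : IsNormalizedMinimizer m n f) (hm : 2 ≤ m)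
    (hn : 2 ≤ n) (x : Euc n) : f x ^ (pExp (m + n) - 2) ≤ f 0 ^ (pExp (m + n) - 2) :=
  Real.rpow_le_rpow (hf.pos x).le (hf.decreasing 0 x (by simp))
    (sub_nonneg.2 (two_lt_pExp hm hn).le)

theorem IsNormalizedMinimizer.integrable_weighted (hf : IsNormalizedMinimizer m n f) (hm : 2 ≤ m)
    (hn : 2 ≤ n) (hb : MemLp b 2) :
    Integrable fun x ↦ f x ^ (pExp (m + n) - 2) * b x ^ 2 := by
  refine hb.integrable_sq.bdd_mul (c := f 0 ^ (pExp (m + n) - 2))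
    (hf.smooth.continuous.rpow_const fun x ↦ .inl (hf.pos x).ne').aestronglyMeasurable
    (.of_forall fun x ↦ ?_)
  rw [Real.norm_of_nonneg (Real.rpow_nonneg (hf.pos x).le _)]
  exact hf.rpow_sub_two_le hm hn x

theorem IsNormalizedMinimizer.weightedNorm_le (hf : IsNormalizedMinimizer m n f) (hm : 2 ≤ m)
    (hn : 2 ≤ n) (hb : MemLp b 2) :
    weightedNorm m n f b ≤ f 0 ^ (pExp (m + n) - 2) * ∫ x, b x ^ 2 := by
  rw [← integral_const_mul]
  exact integral_mono (hf.integrable_weighted hm hn hb) (hb.integrable_sq.const_mul _)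
    fun x ↦ mul_le_mul_of_nonneg_right (hf.rpow_sub_two_le hm hn x) (sq_nonneg _)

theorem IsNormalizedMinimizer.weightedNorm_pos (hf : IsNormalizedMinimizer m n f) (hm : 2 ≤ m)
    (hn : 2 ≤ n) (h : IsNonzeroSobolevPair b G) : 0 < weightedNorm m n f b := by
  have hpos (x) : 0 < f x ^ (pExp (m + n) - 2) := Real.rpow_pos_of_pos (hf.pos x) _
  rw [weightedNorm, integral_pos_iff_support_of_nonneg
    (fun x ↦ mul_nonneg (hpos x).le (sq_nonneg _)) (hf.integrable_weighted hm hn h.memLp)]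
  refine pos_iff_ne_zero.2 fun h0 ↦ h.ne_zero (ae_iff.2 ?_)
  simpa [Function.support, (hpos _).ne'] using h0

theorem IsNormalizedMinimizer.isNonzeroSobolevPair (hf : IsNormalizedMinimizer m n f) :
    IsNonzeroSobolevPair f (∇ f) where
  toIsSobolevPair := hf.sobolev
  ne_zero h := by
    obtain ⟨x, hx⟩ := h.exists
    exact (hf.pos x).ne' hx

/-- Testing the equation of `f` against `f` itself. -/
theorem IsNormalizedMinimizer.energy_eq (hf : IsNormalizedMinimizer m n f) (hm : 2 ≤ m)
    (hn : 2 ≤ n) : energy m n f (∇ f) = scal m * weightedNorm m n f f := by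
  have ha := aConst_pos hm hn
  have hW := hf.integrable_weighted hm hn hf.sobolev.memLp
  have hmul (x) : aConst (m + n) * (f x * Δ f x) =
      scal m * f x ^ 2 - scal m * (f x ^ (pExp (m + n) - 2) * f x ^ 2) := by
    have h1 : f x ^ (pExp (m + n) - 1) = f x ^ (pExp (m + n) - 2) * f x := by
      rw [← Real.rpow_add_one (hf.pos x).ne']
      ring_nf
    have h2 := hf.normalized x
    rw [h1] at h2
    linear_combination -f x * h2
  have hint : Integrable fun x ↦ f x * Δ f x := by
    rw [← integrable_const_mul_iff ha.ne'.isUnit]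
    simp_rw [hmul]
    exact (hf.sobolev.memLp.integrable_sq.const_mul _).sub (hW.const_mul _)
  have hgreen := integral_norm_gradient_sq_add_mul_laplacian
    (contDiff_infty.1 hf.smooth 2) hf.sobolev.memLp hf.sobolev.memLp_grad hint
  have hsum : Integrable fun x ↦ ‖∇ f x‖ ^ 2 + f x * Δ f x :=
    (hf.sobolev.memLp_grad.integrable_norm_pow two_ne_zero).add hint
  calc energy m n f (∇ f)
      = ∫ x, (aConst (m + n) * (‖∇ f x‖ ^ 2 + f x * Δ f x) +
          scal m * (f x ^ (pExp (m + n) - 2) * f x ^ 2)) := by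
        refine integral_congr_ae (.of_forall fun x ↦ ?_)
        linear_combination -hmul x
    _ = scal m * weightedNorm m n f f := by
        rw [integral_add (hsum.const_mul _) (hW.const_mul _), integral_const_mul,
          integral_const_mul, hgreen, mul_zero, zero_add, weightedNorm]

end Integrals

/-! ### The quotient as a family of affine functions -/

section Admissible

/-- The admissible functions of the variational problem for `A`: nonzero Sobolev functions,
together with a weak gradient. -/
abbrev Admissible (n : ℕ) : Type :=
  {q : (Euc n → ℝ) × (Euc n → Euc n) // IsNonzeroSobolevPair q.1 q.2}

/-- The constant term of the affine function of `lam` that an admissible function contributes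
to `A`. -/
def energyRatio (m n : ℕ) (f : Euc n → ℝ) (q : Admissible n) : ℝ :=
  energy m n q.1.1 q.1.2 / weightedNorm m n f q.1.1

/-- The slope, up to the factor `aConst (m + n)`, of the affine function of `lam` that an
admissible function contributes to `A`. -/
def massRatio (m n : ℕ) (f : Euc n → ℝ) (q : Admissible n) : ℝ :=
  (∫ x, q.1.1 x ^ 2) / weightedNorm m n f q.1.1

variable {m n : ℕ} {f : Euc n → ℝ}

theorem quotientValues_eq_range (lam : ℝ) : quotientValues m n f lam =
    Set.range fun q ↦ energyRatio m n f q + aConst (m + n) * lam * massRatio m n f q := by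
  ext y
  constructor
  · rintro ⟨b, G, h, rfl⟩
    exact ⟨⟨(b, G), h⟩, rfl⟩
  · rintro ⟨⟨⟨b, G⟩, h⟩, rfl⟩
    exact ⟨b, G, h, rfl⟩

theorem A_eq_affineInf :
    A m n f = affineInf (energyRatio m n f) (massRatio m n f) (aConst (m + n)) := by
  ext lam
  rw [A, quotientValues_eq_range]
  rfl

theorem IsNormalizedMinimizer.le_massRatio (hf : IsNormalizedMinimizer m n f) (hm : 2 ≤ m)
    (hn : 2 ≤ n) (q : Admissible n) : (f 0 ^ (pExp (m + n) - 2))⁻¹ ≤ massRatio m n f q := by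
  rw [massRatio, le_div_iff₀ (hf.weightedNorm_pos hm hn q.2),
    inv_mul_le_iff₀ (Real.rpow_pos_of_pos (hf.pos 0) _)]
  exact hf.weightedNorm_le hm hn q.2.memLp

theorem IsNormalizedMinimizer.mul_massRatio_le (hf : IsNormalizedMinimizer m n f) (hm : 2 ≤ m)
    (hn : 2 ≤ n) (q : Admissible n) : scal m * massRatio m n f q ≤ energyRatio m n f q := by
  rw [massRatio, energyRatio, ← mul_div_assoc]
  exact div_le_div_of_nonneg_right
    (scal_mul_integral_sq_le_energy hm hn q.2.toIsSobolevPair) (hf.weightedNorm_pos hm hn q.2).le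

end Admissible
end YamabeStability
end

theorem corollary1p4 (m n : ℕ) (hm : 2 ≤ m) (hn : 2 ≤ n)
    (f : YamabeStability.Euc n → ℝ) (hf : YamabeStability.IsNormalizedMinimizer m n f) :
    (∀ lam : ℝ, 0 ≤ lam →
      IsGLB (YamabeStability.quotientValues m n f lam) (YamabeStability.A m n f lam)) ∧
    StrictMonoOn (YamabeStability.A m n f) (Set.Ici 0) ∧
    ∃! lam : ℝ, 0 < lam ∧ YamabeStability.A m n f lam =
      (YamabeStability.pExp (m + n) - 1) * ((m : ℝ) * ((m : ℝ) - 1)) := by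
  let q₀ : YamabeStability.Admissible n := ⟨(f, ∇ f), hf.isNonzeroSobolevPair⟩
  have : Nonempty (YamabeStability.Admissible n) := ⟨q₀⟩
  have ha := YamabeStability.aConst_pos hm hn
  have hs := YamabeStability.scal_pos hm
  have hδ : 0 < (f 0 ^ (YamabeStability.pExp (m + n) - 2))⁻¹ :=
    inv_pos.2 (Real.rpow_pos_of_pos (hf.pos 0) _)
  have hβ := hf.le_massRatio hm hn
  have hα := hf.mul_massRatio_le hm hn
  refine ⟨fun lam hlam ↦ ?_, ?_, ?_⟩
  · rw [YamabeStability.A, YamabeStability.quotientValues_eq_range]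
    exact isGLB_csInf (Set.range_nonempty _)
      (YamabeStability.bddBelow_affine ha hs hδ hβ hα hlam)
  · rw [YamabeStability.A_eq_affineInf]
    exact YamabeStability.strictMonoOn_affineInf ha hs hδ hβ hα
  · rw [YamabeStability.A_eq_affineInf]
    refine YamabeStability.existsUnique_affineInf_eq ha hs hδ hβ hα ?_
    -- The test function `f` has quotient `m (m - 1)` at `lam = 0`, and `1 < p - 1`.
    have h1 : YamabeStability.affineInf (YamabeStability.energyRatio m n f)
        (YamabeStability.massRatio m n f) (YamabeStability.aConst (m + n)) 0 ≤ _ := ciInf_le (YamabeStability.bddBelow_affine ha hs hδ hβ hα le_rfl) q₀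
    have h2 : YamabeStability.energyRatio m n f q₀ = YamabeStability.scal m := by
      rw [YamabeStability.energyRatio, hf.energy_eq hm hn,
        mul_div_cancel_right₀ _ (hf.weightedNorm_pos hm hn hf.isNonzeroSobolevPair).ne']
    rw [h2, mul_zero, zero_mul, add_zero] at h1
    refine h1.trans_lt (lt_mul_of_one_lt_left hs ?_)
    linarith [YamabeStability.two_lt_pExp hm hn]
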